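/- Let $\Gamma$ be a word hyperbolic group, let $|\cdot|$ be the word length of $\Gamma$ with respect to a finite generating set, and let $\partial_\infty\Gamma$ be the Gromov boundary of $\Gamma$. For a matrix $g\in\mathsf{SL}_d(\mathbb{C})$ let $\sigma_1(g)\ge\sigma_2(g)\ge\dots\ge\sigma_d(g)$ be its singular values. Let $m\ge 1$ and let $\mathsf{Sp}_{2m}(\mathbb{C})\subset\mathsf{SL}_{2m}(\mathbb{C})$ be the automorphism group of the standard symplectic form on $\mathbb{C}^{2m}$. Suppose that there is a representation $\rho:\Gamma\to\mathsf{Sp}_{2m}(\mathbb{C})$ which is $1$-Anosov, i.e. there exist constants $c,\mu>0$ such that $$\frac{\sigma_1(\rho(\gamma))}{\sigma_2(\rho(\gamma))}\ \ge\ c\,e^{\mu|\gamma|}\qquad\text{for all }\gamma\in\Gamma.$$ Then $\partial_\infty\Gamma$ does not properly contain a $2$-sphere: there is no proper subset of $\partial_\infty\Gamma$ that is homeomorphic, in the subspace topology, to the sphere $S^2$. -/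

import Mathlib

/-! ### Word metrics -/

namespace WordMetric

variable {Γ : Type*} [Group Γ]

/-- `l` is a word in the letters `S ∪ S⁻¹`. -/
def IsWord (S : Finset Γ) (l : List Γ) : Prop :=
  ∀ s ∈ l, s ∈ S ∨ s⁻¹ ∈ S

/-- The word length of `g` with respect to `S`: the least length of a word in `S ∪ S⁻¹` that
represents `g` (such a word exists for every `g` as soon as `S` generates the group). -/
noncomputable def wordLength (S : Finset Γ) (g : Γ) : ℕ :=
  sInf {n | ∃ l : List Γ, IsWord S l ∧ l.prod = g ∧ l.length = n}

/-- The left-invariant word metric of `S`. -/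
noncomputable def wordDist (S : Finset Γ) (g h : Γ) : ℕ :=
  wordLength S (g⁻¹ * h)

theorem wordLength_le {S : Finset Γ} {l : List Γ} (hl : IsWord S l) :
    wordLength S l.prod ≤ l.length :=
  Nat.sInf_le ⟨l, hl, rfl, rfl⟩

theorem IsWord.append {S : Finset Γ} {l l' : List Γ} (h : IsWord S l) (h' : IsWord S l') :
    IsWord S (l ++ l') := by
  intro s hs
  rcases List.mem_append.1 hs with hs | hs
  · exact h s hs
  · exact h' s hs

theorem IsWord.inv {S : Finset Γ} {l : List Γ} (h : IsWord S l) :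
    IsWord S (l.map (fun x => x⁻¹)).reverse := by
  intro s hs
  obtain ⟨t, ht, rfl⟩ := List.mem_map.1 (List.mem_reverse.1 hs)
  rw [inv_inv]
  exact (h t ht).symm

theorem exists_word {S : Finset Γ} (hS : Subgroup.closure (S : Set Γ) = ⊤) (g : Γ) :
    ∃ l : List Γ, IsWord S l ∧ l.prod = g := by
  have hg : g ∈ Subgroup.closure (S : Set Γ) := hS ▸ Subgroup.mem_top g
  induction hg using Subgroup.closure_induction with
  | mem x hx => exact ⟨[x], by intro s hs; simp_all, by simp⟩
  | one => exact ⟨[], by intro s hs; simp_all, rfl⟩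
  | mul x y _ _ hx hy =>
    obtain ⟨l, hl, rfl⟩ := hx
    obtain ⟨l', hl', rfl⟩ := hy
    exact ⟨l ++ l', hl.append hl', List.prod_append⟩
  | inv x _ hx =>
    obtain ⟨l, hl, rfl⟩ := hx
    exact ⟨_, hl.inv, (List.prod_inv_reverse l).symm⟩

theorem exists_word_length {S : Finset Γ} (hS : Subgroup.closure (S : Set Γ) = ⊤) (g : Γ) :
    ∃ l : List Γ, IsWord S l ∧ l.prod = g ∧ l.length = wordLength S g := by
  obtain ⟨l, hl, h⟩ := exists_word hS g
  exact Nat.sInf_mem (s := {n | ∃ l : List Γ, IsWord S l ∧ l.prod = g ∧ l.length = n})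
    ⟨l.length, l, hl, h, rfl⟩

theorem wordDist_self (S : Finset Γ) (g : Γ) : wordDist S g g = 0 := by
  have h : wordLength S ([] : List Γ).prod ≤ ([] : List Γ).length :=
    wordLength_le (fun s hs => by simp at hs)
  simpa [wordDist] using h

theorem wordDist_comm_le {S : Finset Γ} (hS : Subgroup.closure (S : Set Γ) = ⊤) (g h : Γ) :
    wordDist S g h ≤ wordDist S h g := by
  obtain ⟨l, hl, h1, h2⟩ := exists_word_length hS (h⁻¹ * g)
  have h3 := wordLength_le hl.inv
  rw [← List.prod_inv_reverse, h1] at h3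
  simpa [wordDist, h2] using h3

theorem wordDist_triangle {S : Finset Γ} (hS : Subgroup.closure (S : Set Γ) = ⊤) (g h k : Γ) :
    wordDist S g k ≤ wordDist S g h + wordDist S h k := by
  obtain ⟨l, hl, h1, h2⟩ := exists_word_length hS (g⁻¹ * h)
  obtain ⟨l', hl', h1', h2'⟩ := exists_word_length hS (h⁻¹ * k)
  have h3 := wordLength_le (hl.append hl')
  rw [List.prod_append, h1, h1', List.length_append, h2, h2'] at h3
  simpa [wordDist, mul_assoc] using h3

/-- The Gromov product `(x | y)_w` in the word metric. -/
noncomputable def gromovProduct (S : Finset Γ) (w x y : Γ) : ℝ :=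
  ((wordDist S w x : ℝ) + wordDist S w y - wordDist S x y) / 2

/-- The word metric of `S` is Gromov hyperbolic (four-point condition). A group is word hyperbolic
if this holds for a finite generating set `S`, equivalently for all of them. -/
def IsHyperbolic (S : Finset Γ) : Prop :=
  ∃ δ : ℝ, ∀ w x y z : Γ,
    min (gromovProduct S w x y) (gromovProduct S w y z) - δ ≤ gromovProduct S w x z

/-! ### The Gromov boundary -/

/-- Geodesic rays issuing from `1` in the Cayley graph of `S`, recorded by their vertices. -/
def Ray (S : Finset Γ) : Type _ :=
  {r : ℕ → Γ // r 0 = 1 ∧ ∀ i j : ℕ, wordDist S (r i) (r (i + j)) = j}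

/-- The topology of pointwise convergence on rays, `Γ` being discrete; it is the topology of uniform
convergence on bounded sets. -/
instance (S : Finset Γ) : TopologicalSpace (Ray S) :=
  TopologicalSpace.induced Subtype.val (@Pi.topologicalSpace ℕ (fun _ => Γ) (fun _ => ⊥))

/-- Two rays are asymptotic if they stay at bounded distance. -/
def raySetoid (S : Finset Γ) (hS : Subgroup.closure (S : Set Γ) = ⊤) : Setoid (Ray S) where
  r a b := ∃ C : ℕ, ∀ n : ℕ, wordDist S (a.1 n) (b.1 n) ≤ C
  iseqv :=
    { refl := fun a => ⟨0, fun n => (wordDist_self S (a.1 n)).le⟩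
      symm := fun ⟨C, h⟩ => ⟨C, fun n => (wordDist_comm_le hS _ _).trans (h n)⟩
      trans := fun ⟨C, h⟩ ⟨D, k⟩ =>
        ⟨C + D, fun n => (wordDist_triangle hS _ _ _).trans (add_le_add (h n) (k n))⟩ }

/-- The Gromov boundary: geodesic rays from the identity modulo being asymptotic, with the
quotient topology. -/
def GromovBoundary (S : Finset Γ) (hS : Subgroup.closure (S : Set Γ) = ⊤) : Type _ :=
  Quotient (raySetoid S hS)

instance (S : Finset Γ) (hS : Subgroup.closure (S : Set Γ) = ⊤) :
    TopologicalSpace (GromovBoundary S hS) :=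
  inferInstanceAs (TopologicalSpace (Quotient (raySetoid S hS)))

end WordMetric

/-! ### Anosov representations -/

namespace Anosov

/-- The `i`-th singular value of a complex matrix, `i = 1, 2, …`, in non-increasing order
(Mathlib numbers singular values from `0`). -/
noncomputable def sigma {n : Type*} [Fintype n] [DecidableEq n] (i : ℕ) (g : Matrix n n ℂ) : ℝ :=
  (Matrix.toEuclideanLin g).singularValues (i - 1)

/-- A representation into `SL_d(ℂ)` is `k`-Anosov, `1 ≤ k ≤ d / 2`, if
`σ_k(ρ(γ)) / σ_{k+1}(ρ(γ)) ≥ c * exp (μ * |γ|)` for all `γ`, with constants `c, μ > 0`. -/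
def IsAnosov {Γ : Type*} [Group Γ] (S : Finset Γ) {n : Type*} [Fintype n] [DecidableEq n]
    (k : ℕ) (ρ : Γ →* Matrix.SpecialLinearGroup n ℂ) : Prop :=
  1 ≤ k ∧ 2 * k ≤ Fintype.card n ∧
    ∃ c μ : ℝ, 0 < c ∧ 0 < μ ∧ ∀ γ : Γ,
      c * Real.exp (μ * WordMetric.wordLength S γ) ≤
        sigma k (ρ γ : Matrix n n ℂ) / sigma (k + 1) (ρ γ : Matrix n n ℂ)

/-- The inclusion of `Sp_{2m}(ℂ)` into `SL_{2m}(ℂ)`. -/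
def spToSL (m : ℕ) :
    Matrix.symplecticGroup (Fin m) ℂ →* Matrix.SpecialLinearGroup (Fin m ⊕ Fin m) ℂ where
  toFun g := ⟨g.1, SymplecticGroup.det_eq_one g.2⟩
  map_one' := rfl
  map_mul' _ _ := rfl

end Anosov

/-! The singular value gap puts the image of the unit ball under ρ(γ), rescaled by the norm,
exponentially close to a complex line. Along a geodesic ray these lines converge, which gives a
continuous map ξ from the boundary to the lines of ℂ²ᵐ (`HasGap.exists_limitMap`).

The symplectic form ω makes ξ transverse: ω is nonzero on ξ(a) × ξ(b) for a ≠ b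
(`IsInvariantForm.ne_zero_of_not_asymptotic`). Otherwise join two rays to a bi-infinite path. By
equivariance, the forward and backward limit lines seen from every vertex are ω-orthogonal, so the
norm along a segment of length 2^(p+1) is at most a constant times exp(-μ 2^p) times the product of
the norms along its halves. Iterating pushes the norm below 1, which is impossible for symplectic
operators.

If a sphere A misses a boundary point y, the functional ω(·, ξ(y)) vanishes on no line ξ(x) with x
in A, so ξ lifts over A to a continuous nonvanishing f : S² → ℂ²ᵐ. The function x ↦ ω(f(x), f(-x))
is odd because ω is alternating. By Borsuk–Ulam it has a zero, against transversality. -/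

/-! ### The Borsuk–Ulam theorem on the two-sphere -/

namespace BorsukUlam

/-- A continuous nowhere vanishing function on `ℂ` has a continuous logarithm. -/
theorem exists_continuous_log {G : ℂ → ℂ} (hG : Continuous G) (h0 : ∀ z, G z ≠ 0) :
    ∃ h : ℂ → ℂ, Continuous h ∧ ∀ z, Complex.exp (h z) = G z := by
  -- The exponential is a covering of the punctured plane and ℂ is simply connected, so `G` lifts.
  obtain ⟨h, ⟨-, hh⟩, -⟩ := Complex.isCoveringMapOn_exp.existsUnique_continuousMap_lifts
    ⟨G, hG⟩ (a₀ := 0) (e₀ := Complex.log (G 0)) (Complex.exp_log (h0 0)) (fun z => h0 z)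
  exact ⟨h, h.continuous, fun z => congrFun hh z⟩

/-- Lift of the plane to three-space; the closed unit disk is sent to the upper hemisphere. -/
noncomputable def hemisphere (z : ℂ) : EuclideanSpace ℝ (Fin 3) :=
  -- Outside the unit disk the real square root is 0 by convention, so the map is continuous and
  -- nonvanishing on all of ℂ and logarithms can be taken over the whole plane.
  !₂[z.re, z.im, Real.sqrt (1 - ‖z‖ ^ 2)]

theorem continuous_hemisphere : Continuous hemisphere := by
  refine (PiLp.continuous_toLp 2 _).comp (continuous_pi fun i => ?_)
  fin_cases i
  · exact Complex.continuous_re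
  · exact Complex.continuous_im
  · exact ((continuous_const.sub (continuous_norm.pow 2)).sqrt :
      Continuous fun z : ℂ => Real.sqrt (1 - ‖z‖ ^ 2))

theorem hemisphere_ne_zero (z : ℂ) : hemisphere z ≠ 0 := by
  intro h
  have h0 : z.re = 0 := by simpa [hemisphere] using congrArg (fun v => v 0) h
  have h1 : z.im = 0 := by simpa [hemisphere] using congrArg (fun v => v 1) h
  have h2 : Real.sqrt (1 - ‖z‖ ^ 2) = 0 := by
    simpa [hemisphere] using congrArg (fun v => v 2) h
  have hz : z = 0 := Complex.ext h0 h1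
  simp [hz] at h2

theorem hemisphere_neg {z : ℂ} (hz : ‖z‖ = 1) : hemisphere (-z) = -hemisphere z := by
  ext i
  fin_cases i <;> simp [hemisphere, hz]

/-- Radial projection of `hemisphere` to the unit sphere. -/
noncomputable def spherePoint (z : ℂ) : Metric.sphere (0 : EuclideanSpace ℝ (Fin 3)) 1 :=
  ⟨‖hemisphere z‖⁻¹ • hemisphere z, by
    have := norm_ne_zero_iff.2 (hemisphere_ne_zero z)
    simp [norm_smul, this]⟩

theorem continuous_spherePoint : Continuous spherePoint :=
  ((continuous_hemisphere.norm.inv₀ fun z => norm_ne_zero_iff.2 (hemisphere_ne_zero z)).smul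
    continuous_hemisphere).subtype_mk _

theorem spherePoint_neg {z : ℂ} (hz : ‖z‖ = 1) : spherePoint (-z) = -spherePoint z := by
  ext1
  simp [spherePoint, hemisphere_neg hz]

/-- An odd continuous function from the two-sphere to the plane has a zero. -/
theorem exists_eq_zero_of_odd {g : Metric.sphere (0 : EuclideanSpace ℝ (Fin 3)) 1 → ℂ}
    (hg : Continuous g) (hodd : ∀ x, g (-x) = -g x) : ∃ x, g x = 0 := by
  by_contra! hne
  obtain ⟨h, hc, he⟩ := exists_continuous_log (hg.comp continuous_spherePoint) fun z => hne _
  have key : ∀ z : ℂ, ‖z‖ = 1 → Complex.exp (h (-z) - h z) = -1 := fun z hz => by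
    rw [Complex.exp_sub, he, he, Function.comp_apply, Function.comp_apply, spherePoint_neg hz,
      hodd, neg_div, div_self (hne _)]
  let c : ℝ → ℂ := fun t => Complex.exp (t * Complex.I)
  have hcc : Continuous c := by fun_prop
  have hcn : ∀ t, ‖c t‖ = 1 := Complex.norm_exp_ofReal_mul_I
  -- A half turn of the circle swaps `c t` and `-c t`, so `f` changes sign and has a zero. There the
  -- exponent in `key` is real and its exponential cannot be -1.
  let f : ℝ → ℝ := fun t => (h (-c t) - h (c t)).im
  have hf : Continuous f := by
    simp only [f]
    fun_prop
  have hpi : f Real.pi = -f 0 := by simp [f, c]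
  obtain ⟨t, ht⟩ : ∃ t, f t = 0 := by
    rcases le_total 0 (f 0) with h' | h'
    · exact mem_range_of_exists_le_of_exists_ge hf ⟨Real.pi, by linarith⟩ ⟨0, h'⟩
    · exact mem_range_of_exists_le_of_exists_ge hf ⟨0, h'⟩ ⟨Real.pi, by linarith⟩
  have h1 := key _ (hcn t)
  have h2 : (Complex.exp (h (-c t) - h (c t))).re = -1 := by rw [h1]; simp
  rw [Complex.exp_re, show (h (-c t) - h (c t)).im = 0 from ht, Real.cos_zero, mul_one] at h2
  linarith [Real.exp_pos (h (-c t) - h (c t)).re]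

end BorsukUlam

/-! ### Attracting lines of operators -/

namespace AttractingLine

open InnerProductSpace

variable {E : Type*} [NormedAddCommGroup E] [InnerProductSpace ℂ E]

/-- Orthogonal projections onto lines. -/
def IsLineProj (P : E →L[ℂ] E) : Prop :=
  ∃ u : E, ‖u‖ = 1 ∧ P = rankOne ℂ u u

theorem IsLineProj.norm_eq {P : E →L[ℂ] E} (hP : IsLineProj P) : ‖P‖ = 1 := by
  obtain ⟨u, hu, rfl⟩ := hP
  simp [hu]

theorem isClosed_setOf_isLineProj [FiniteDimensional ℂ E] :
    IsClosed {P : E →L[ℂ] E | IsLineProj P} := by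
  have : ProperSpace E := FiniteDimensional.proper ℂ E
  have h : {P : E →L[ℂ] E | IsLineProj P} =
      (fun u => rankOne ℂ u u) '' Metric.sphere (0 : E) 1 := by
    ext P
    simp [IsLineProj, eq_comm]
  rw [h]
  refine ((isCompact_sphere 0 1).image ?_).isClosed
  exact ((ContinuousLinearMap.smulRightL ℂ E E).continuous.comp
    (innerSL ℂ).continuous).clm_apply continuous_id

/-- The orthogonal projection is the best approximation on a line. -/
theorem norm_sub_rankOne_le {u : E} (hu : ‖u‖ = 1) (y : E) (a : ℂ) :
    ‖y - rankOne ℂ u u y‖ ≤ ‖y - a • u‖ := by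
  have h : y - a • u = (y - rankOne ℂ u u y) + (inner ℂ u y - a) • u := by
    simp [sub_smul]
  have hin : inner ℂ u u = (1 : ℂ) := by
    rw [inner_self_eq_norm_sq_to_K, hu]; simp
  have h0 : inner ℂ (y - rankOne ℂ u u y) ((inner ℂ u y - a) • u) = (0 : ℂ) := by
    rw [inner_smul_right, inner_sub_left, rankOne_apply, inner_smul_left, hin, inner_conj_symm]
    simp
  have := norm_add_sq_eq_norm_sq_add_norm_sq_of_inner_eq_zero _ _ h0
  rw [← h] at this
  nlinarith [norm_nonneg (y - a • u), norm_nonneg (y - rankOne ℂ u u y),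
    mul_self_nonneg ‖(inner ℂ u y - a) • u‖]

/-- A unit vector close to a line spans a line close to it. -/
theorem norm_rankOne_sub_rankOne_le {u y : E} (hu : ‖u‖ = 1) (hy : ‖y‖ = 1) :
    ‖rankOne ℂ y y - rankOne ℂ u u‖ ≤ 3 * ‖y - rankOne ℂ u u y‖ := by
  set c : ℂ := inner ℂ u y with hc
  set e : E := y - rankOne ℂ u u y with he
  have hye : y = c • u + e := by simp [he, hc]
  have hin : inner ℂ u u = (1 : ℂ) := by
    rw [inner_self_eq_norm_sq_to_K, hu]; simp
  have hue : inner ℂ u e = (0 : ℂ) := by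
    rw [he, inner_sub_right, rankOne_apply, inner_smul_right, hin]; simp
  have he1 : ‖e‖ ≤ 1 := by
    have := norm_sub_rankOne_le hu y 0
    rwa [zero_smul, sub_zero, hy] at this
  have hcn : ‖c‖ ≤ 1 := by
    have := norm_inner_le_norm (𝕜 := ℂ) u y
    rwa [hu, hy, one_mul] at this
  have hpy : 1 - ‖c‖ ^ 2 = ‖e‖ ^ 2 := by
    have h0 : inner ℂ (c • u) e = (0 : ℂ) := by rw [inner_smul_left, hue, mul_zero]
    have := norm_add_sq_eq_norm_sq_add_norm_sq_of_inner_eq_zero _ _ h0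
    rw [← hye, hy, norm_smul, hu] at this
    linarith
  refine ContinuousLinearMap.opNorm_le_bound _ (by positivity) fun x => ?_
  -- Each of the three terms has norm at most ‖e‖ ‖x‖, whence the factor 3.
  have hx : (rankOne ℂ y y - rankOne ℂ u u) x =
      -(((‖e‖ ^ 2 : ℝ) : ℂ) * inner ℂ u x) • u + (starRingEnd ℂ c * inner ℂ u x) • e
        + inner ℂ e x • y := by
    have h1 : inner ℂ y x = starRingEnd ℂ c * inner ℂ u x + inner ℂ e x := by
      conv_lhs => rw [hye]
      rw [inner_add_left, inner_smul_left]
    have h2 : starRingEnd ℂ c * c = ((‖c‖ ^ 2 : ℝ) : ℂ) := by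
      rw [Complex.conj_mul']; simp
    have h3 : (starRingEnd ℂ c * inner ℂ u x) • y =
        (starRingEnd ℂ c * c * inner ℂ u x) • u + (starRingEnd ℂ c * inner ℂ u x) • e := by
      conv_lhs => rw [hye]
      rw [smul_add, smul_smul]
      ring_nf
    rw [sub_apply, rankOne_apply, rankOne_apply, h1, add_smul, h3, h2, ← hpy]
    push_cast
    module
  have hux : ‖(inner ℂ u x : ℂ)‖ ≤ ‖x‖ := by
    simpa [hu] using norm_inner_le_norm (𝕜 := ℂ) u x
  have hex : ‖(inner ℂ e x : ℂ)‖ ≤ ‖e‖ * ‖x‖ := norm_inner_le_norm e x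
  rw [hx]
  have t1 : ‖-(((‖e‖ ^ 2 : ℝ) : ℂ) * inner ℂ u x) • u‖ ≤ ‖e‖ * ‖x‖ := by
    rw [norm_smul, norm_neg, norm_mul, hu, mul_one, Complex.norm_real,
      Real.norm_of_nonneg (by positivity)]
    gcongr
    nlinarith [norm_nonneg e]
  have t2 : ‖(starRingEnd ℂ c * inner ℂ u x) • e‖ ≤ ‖e‖ * ‖x‖ := by
    rw [norm_smul, norm_mul, RCLike.norm_conj, mul_comm]
    gcongr
    calc ‖c‖ * ‖(inner ℂ u x : ℂ)‖ ≤ 1 * ‖x‖ := by gcongr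
      _ = ‖x‖ := one_mul _
  have t3 : ‖(inner ℂ e x : ℂ) • y‖ ≤ ‖e‖ * ‖x‖ := by
    rw [norm_smul, hy, mul_one]
    exact hex
  calc _ ≤ ‖e‖ * ‖x‖ + ‖e‖ * ‖x‖ + ‖e‖ * ‖x‖ :=
        (norm_add_le _ _).trans (add_le_add ((norm_add_le _ _).trans (add_le_add t1 t2)) t3)
    _ = _ := by ring

/-- `T` maps the unit ball `ε ‖T‖`-close to the range of `P`. -/
def Attracts (T P : E →L[ℂ] E) (ε : ℝ) : Prop :=
  ‖T - P * T‖ ≤ ε * ‖T‖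

theorem Attracts.mono {T P : E →L[ℂ] E} {ε ε' : ℝ} (h : Attracts T P ε) (hε : ε ≤ ε') :
    Attracts T P ε' :=
  le_trans h (by gcongr)

theorem Attracts.apply {T P : E →L[ℂ] E} {ε : ℝ} (h : Attracts T P ε) (x : E) :
    ‖T x - P (T x)‖ ≤ ε * ‖T‖ * ‖x‖ :=
  ((T - P * T).le_opNorm x).trans (by gcongr; exact h)

theorem Attracts.of_norm_sub_le {T P Q : E →L[ℂ] E} {ε δ : ℝ} (h : Attracts T P ε)
    (hPQ : ‖P - Q‖ ≤ δ) : Attracts T Q (ε + δ) := by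
  have : T - Q * T = (T - P * T) + (P - Q) * T := by noncomm_ring
  calc ‖T - Q * T‖ ≤ ‖T - P * T‖ + ‖P - Q‖ * ‖T‖ := by
        rw [this]
        exact (norm_add_le _ _).trans (by gcongr; exact norm_mul_le _ _)
    _ ≤ ε * ‖T‖ + δ * ‖T‖ := add_le_add h (by gcongr)
    _ = _ := by ring

/-- An invertible factor on the right does not change the range. One `κ` bounds ‖s‖, the other comes
from ‖T‖ ≤ ‖T s‖ ‖t‖. -/
theorem Attracts.mul_right {T P s t : E →L[ℂ] E} {ε κ : ℝ} (h : Attracts T P ε) (hε : 0 ≤ ε)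
    (hst : s * t = 1) (hs : ‖s‖ ≤ κ) (ht : ‖t‖ ≤ κ) : Attracts (T * s) P (κ ^ 2 * ε) := by
  have hκ : 0 ≤ κ := (norm_nonneg s).trans hs
  have h1 : ‖T‖ ≤ ‖T * s‖ * κ := by
    calc ‖T‖ = ‖T * s * t‖ := by rw [mul_assoc, hst, mul_one]
      _ ≤ ‖T * s‖ * ‖t‖ := norm_mul_le _ _
      _ ≤ _ := by gcongr
  calc ‖T * s - P * (T * s)‖ = ‖(T - P * T) * s‖ := by congr 1
    _ ≤ ‖T - P * T‖ * ‖s‖ := norm_mul_le _ _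
    _ ≤ ε * ‖T‖ * κ := by
        gcongr
        exact h
    _ ≤ ε * (‖T * s‖ * κ) * κ := by gcongr
    _ = _ := by ring

variable [FiniteDimensional ℂ E]

/-- In finite dimension the operator norm is attained. -/
theorem exists_norm_eq_one_norm_apply_eq [Nontrivial E] (T : E →L[ℂ] E) :
    ∃ x : E, ‖x‖ = 1 ∧ ‖T x‖ = ‖T‖ := by
  have : ProperSpace E := FiniteDimensional.proper ℂ E
  obtain ⟨x, hx, hmax⟩ := (isCompact_sphere (0 : E) 1).exists_isMaxOn
    (NormedSpace.sphere_nonempty.2 zero_le_one) (T.continuous.norm.continuousOn)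
  have hx1 : ‖x‖ = 1 := by simpa using hx
  refine ⟨x, hx1, le_antisymm (by simpa [hx1] using T.le_opNorm x) ?_⟩
  refine ContinuousLinearMap.opNorm_le_of_unit_norm (norm_nonneg _) fun y hy => ?_
  exact hmax (by simpa using hy)

/-- Near-uniqueness of the attracting line. -/
theorem Attracts.norm_sub_le [Nontrivial E] {T P Q : E →L[ℂ] E} {ε ε' : ℝ} (hT : T ≠ 0)
    (hP : IsLineProj P) (hQ : IsLineProj Q) (h : Attracts T P ε) (h' : Attracts T Q ε') :
    ‖P - Q‖ ≤ 3 * (ε + ε') := by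
  obtain ⟨x, hx, hTx⟩ := exists_norm_eq_one_norm_apply_eq T
  have hT0 : 0 < ‖T‖ := norm_pos_iff.2 hT
  -- The error in `Attracts` is relative to ‖T‖, so the normalised image of a norm-attaining vector
  -- is close to both lines.
  set y : E := ((‖T‖⁻¹ : ℝ) : ℂ) • T x with hy
  have hy1 : ‖y‖ = 1 := by
    rw [hy, norm_smul, hTx, Complex.norm_real, norm_inv, norm_norm, inv_mul_cancel₀ hT0.ne']
  have main : ∀ {R : E →L[ℂ] E} {η : ℝ}, IsLineProj R → Attracts T R η →
      ‖rankOne ℂ y y - R‖ ≤ 3 * η := by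
    rintro R η ⟨u, hu, rfl⟩ hR
    refine (norm_rankOne_sub_rankOne_le hu hy1).trans ?_
    have h1 := hR.apply x
    rw [hx, mul_one] at h1
    have h2 : y - rankOne ℂ u u y = ((‖T‖⁻¹ : ℝ) : ℂ) • (T x - rankOne ℂ u u (T x)) := by
      rw [hy, map_smul, smul_sub]
    rw [h2, norm_smul, Complex.norm_real, norm_inv, norm_norm]
    gcongr
    rw [inv_mul_le_iff₀ hT0]
    linarith
  calc ‖P - Q‖ = ‖(rankOne ℂ y y - Q) - (rankOne ℂ y y - P)‖ := by congr 1; abel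
    _ ≤ 3 * ε' + 3 * ε := (_root_.norm_sub_le _ _).trans (add_le_add (main hQ h') (main hP h))
    _ = _ := by ring

open Module in
/-- The largest singular value is at most the operator norm. -/
theorem singularValues_zero_le_norm [Nontrivial E] (T : E →L[ℂ] E) :
    (T : E →ₗ[ℂ] E).singularValues 0 ≤ ‖T‖ := by
  set L : E →ₗ[ℂ] E := T.toLinearMap
  have hn : 0 < finrank ℂ E := finrank_pos
  set b := L.isSymmetric_adjoint_comp_self.eigenvectorBasis rfl
  have hb := L.isSymmetric_adjoint_comp_self.apply_eigenvectorBasis rfl ⟨0, hn⟩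
  have h1 : ‖T (b ⟨0, hn⟩)‖ ^ 2 = L.singularValues 0 ^ 2 := by
    rw [L.sq_singularValues_of_lt rfl hn, ← inner_self_eq_norm_sq (𝕜 := ℂ)]
    change RCLike.re (inner ℂ (L (b ⟨0, hn⟩)) (L (b ⟨0, hn⟩))) = _
    rw [← LinearMap.adjoint_inner_right, ← LinearMap.comp_apply, hb, inner_smul_right,
      inner_self_eq_norm_sq_to_K, b.norm_eq_one]
    simp
  have h2 : ‖T (b ⟨0, hn⟩)‖ ≤ ‖T‖ := by
    simpa using T.le_opNorm (b ⟨0, hn⟩)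
  have h3 := L.singularValues_nonneg 0
  nlinarith [norm_nonneg (T (b ⟨0, hn⟩))]

open Module in
/-- Off the top right-singular direction an operator is bounded by its second singular value. -/
theorem exists_norm_apply_sub_le [Nontrivial E] (T : E →L[ℂ] E) :
    ∃ v : E, ∀ x, ‖T x - inner ℂ v x • T v‖ ≤ (T : E →ₗ[ℂ] E).singularValues 1 * ‖x‖ := by
  set L : E →ₗ[ℂ] E := T.toLinearMap
  have hn : 0 < finrank ℂ E := finrank_pos
  have hS := L.isSymmetric_adjoint_comp_self
  set b := hS.eigenvectorBasis rfl with hb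
  set o : Fin (finrank ℂ E) := ⟨0, hn⟩
  refine ⟨b o, fun x => ?_⟩
  set z : E := x - inner ℂ (b o) x • b o with hz
  have hTz : T x - inner ℂ (b o) x • T (b o) = L z := by
    rw [hz, map_sub, map_smul]; rfl
  have hzx : ‖z‖ ≤ ‖x‖ := by
    have := norm_sub_rankOne_le (b.norm_eq_one o) x 0
    simpa [hz] using this
  have hs1 := L.singularValues_nonneg 1
  have hsq : ‖L z‖ ^ 2 ≤ L.singularValues 1 ^ 2 * ‖z‖ ^ 2 := by
    have e1 : ‖L z‖ ^ 2 = ∑ i : Fin (finrank ℂ E), L.singularValues i ^ 2 * ‖b.repr z i‖ ^ 2 := by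
      rw [← inner_self_eq_norm_sq (𝕜 := ℂ), ← LinearMap.adjoint_inner_right,
        ← LinearMap.comp_apply, ← b.repr.inner_map_map, PiLp.inner_apply, map_sum]
      refine Finset.sum_congr rfl fun i _ => ?_
      rw [hb, hS.eigenvectorBasis_apply_self_apply, ← hb, L.sq_singularValues_fin rfl i,
        RCLike.inner_apply, mul_assoc, RCLike.mul_conj]
      simp only [← RCLike.ofReal_pow, ← RCLike.ofReal_mul, RCLike.ofReal_re]
    have e2 : ‖z‖ ^ 2 = ∑ i, ‖b.repr z i‖ ^ 2 := by
      rw [← b.repr.norm_map, EuclideanSpace.norm_sq_eq]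
    rw [e1, e2, Finset.mul_sum]
    -- The top coordinate of `z` vanishes, and the other singular values are at most the second one.
    refine Finset.sum_le_sum fun i _ => ?_
    by_cases hi : i = o
    · have : b.repr z i = 0 := by
        rw [hi, b.repr_apply_apply, hz, inner_sub_right, inner_smul_right,
          inner_self_eq_norm_sq_to_K, b.norm_eq_one]
        simp
      simp [this]
    · have h1i : 1 ≤ (i : ℕ) := by
        rcases Nat.eq_zero_or_pos (i : ℕ) with h | h
        · exact absurd (Fin.ext h) hi
        · exact h
      have := L.singularValues_antitone h1i
      have := L.singularValues_nonneg i
      gcongr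
  rw [hTz]
  have : ‖L z‖ ≤ L.singularValues 1 * ‖z‖ := by
    refine le_of_sq_le_sq ?_ (by positivity)
    rwa [mul_pow]
  exact this.trans (by gcongr)

/-- A gap between the first two singular values yields an attracting line. -/
theorem exists_attracts [Nontrivial E] (T : E →L[ℂ] E) {ε : ℝ}
    (h : (T : E →ₗ[ℂ] E).singularValues 1 ≤ ε * (T : E →ₗ[ℂ] E).singularValues 0)
    (hε : 0 ≤ ε) : ∃ P, IsLineProj P ∧ Attracts T P ε := by
  obtain ⟨v, hv⟩ := exists_norm_apply_sub_le T
  -- The attracting line is spanned by the image of the top right-singular vector; if that image is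
  -- 0, any line serves.
  obtain ⟨u, hu, a, ha⟩ : ∃ u : E, ‖u‖ = 1 ∧ ∃ a : ℂ, T v = a • u := by
    by_cases h0 : T v = 0
    · obtain ⟨u, hu⟩ := exists_norm_eq E (zero_le_one (α := ℝ))
      exact ⟨u, hu, 0, by simp [h0]⟩
    · have h1 : ‖T v‖ ≠ 0 := norm_ne_zero_iff.2 h0
      refine ⟨((‖T v‖⁻¹ : ℝ) : ℂ) • T v, ?_, (‖T v‖ : ℂ), ?_⟩
      · rw [norm_smul, Complex.norm_real, norm_inv, norm_norm, inv_mul_cancel₀ h1]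
      · rw [smul_smul, ← Complex.ofReal_mul, mul_inv_cancel₀ h1, Complex.ofReal_one, one_smul]
  refine ⟨rankOne ℂ u u, ⟨u, hu, rfl⟩, ContinuousLinearMap.opNorm_le_bound _ (by positivity) ?_⟩
  intro x
  calc ‖(T - rankOne ℂ u u * T) x‖ ≤ ‖T x - (inner ℂ v x * a) • u‖ :=
        norm_sub_rankOne_le hu (T x) _
    _ ≤ (T : E →ₗ[ℂ] E).singularValues 1 * ‖x‖ := by
        rw [mul_smul, ← ha]
        exact hv x
    _ ≤ ε * ‖T‖ * ‖x‖ := by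
        gcongr
        exact h.trans (by gcongr; exact singularValues_zero_le_norm T)

end AttractingLine

/-! ### Rays in hyperbolic groups -/

namespace WordMetric

variable {Γ : Type*} [Group Γ] {S : Finset Γ}

theorem wordDist_comm (hS : Subgroup.closure (S : Set Γ) = ⊤) (g h : Γ) :
    wordDist S g h = wordDist S h g :=
  le_antisymm (wordDist_comm_le hS g h) (wordDist_comm_le hS h g)

theorem wordDist_mul_left (a g h : Γ) : wordDist S (a * g) (a * h) = wordDist S g h := by
  simp [wordDist, mul_assoc]

theorem Ray.wordDist_of_le (r : Ray S) {i j : ℕ} (h : i ≤ j) :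
    wordDist S (r.1 i) (r.1 j) = j - i := by
  obtain ⟨k, rfl⟩ := Nat.exists_eq_add_of_le h
  simpa using r.2.2 i k

theorem Ray.wordDist_one (r : Ray S) (i : ℕ) : wordDist S 1 (r.1 i) = i := by
  have := r.2.2 0 i
  rwa [r.2.1, zero_add] at this

theorem Ray.gromovProduct_of_le (r : Ray S) {i j : ℕ} (h : i ≤ j) :
    gromovProduct S 1 (r.1 i) (r.1 j) = i := by
  rw [gromovProduct, r.wordDist_one, r.wordDist_one, r.wordDist_of_le h, Nat.cast_sub h]
  ring

theorem gromovProduct_comm (hS : Subgroup.closure (S : Set Γ) = ⊤) (w x y : Γ) :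
    gromovProduct S w x y = gromovProduct S w y x := by
  rw [gromovProduct, gromovProduct, wordDist_comm hS x y]
  ring

/-- Rays that are not asymptotic diverge at full speed. -/
theorem exists_le_wordDist_of_not_asymptotic (hS : Subgroup.closure (S : Set Γ) = ⊤)
    (hΓ : IsHyperbolic S) {r r' : Ray S} (h : ¬ (raySetoid S hS).r r r') :
    ∃ B : ℕ, ∀ n k : ℕ, n + k ≤ wordDist S (r.1 n) (r'.1 k) + B := by
  obtain ⟨δ, hδ⟩ := hΓ
  -- If n + k exceeded the distance by more than 2m, the Gromov product of `r n` and `r' k` would be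
  -- at least m. Two uses of the four-point condition would then give (r m | r' m) ≥ m - 2δ, so `r
  -- m` and `r' m` would be at distance at most 4δ.
  obtain ⟨m, hm⟩ : ∃ m, 4 * δ < wordDist S (r.1 m) (r'.1 m) := by
    by_contra! hcon
    refine h ⟨⌊4 * δ⌋₊, fun n => Nat.le_floor (hcon n)⟩
  refine ⟨2 * m, fun n k => ?_⟩
  by_contra! hlt
  have hlt' : (wordDist S (r.1 n) (r'.1 k) : ℝ) + 2 * m < n + k := by exact_mod_cast hlt
  have hprod : (m : ℝ) ≤ gromovProduct S 1 (r.1 n) (r'.1 k) := by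
    rw [gromovProduct, r.wordDist_one, r'.wordDist_one]
    linarith
  have hmn : m ≤ n := by
    have h1 := wordDist_triangle hS 1 (r.1 n) (r'.1 k)
    rw [r.wordDist_one, r'.wordDist_one] at h1
    omega
  have hmk : m ≤ k := by
    have h1 := wordDist_triangle hS 1 (r'.1 k) (r.1 n)
    rw [r.wordDist_one, r'.wordDist_one, wordDist_comm hS] at h1
    omega
  have h1 := hδ 1 (r.1 m) (r.1 n) (r'.1 k)
  have h2 := hδ 1 (r.1 m) (r'.1 k) (r'.1 m)
  rw [r.gromovProduct_of_le hmn, min_eq_left hprod] at h1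
  rw [gromovProduct_comm hS 1 (r'.1 k), r'.gromovProduct_of_le hmk] at h2
  have hδ0 : 0 ≤ δ := by
    have := hδ 1 1 1 1
    simp only [min_self] at this
    linarith
  have h3 : (m : ℝ) - δ ≤ min (gromovProduct S 1 (r.1 m) (r'.1 k)) m :=
    le_min h1 (by linarith)
  have h4 : (m : ℝ) - 2 * δ ≤ gromovProduct S 1 (r.1 m) (r'.1 m) := by linarith
  rw [gromovProduct, r.wordDist_one, r'.wordDist_one] at h4
  linarith

/-- The bi-infinite path formed by two rays. -/
def biPath (r r' : Ray S) (i : ℤ) : Γ :=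
  if 0 ≤ i then r.1 i.toNat else r'.1 (-i).toNat

theorem biPath_of_nonneg (r r' : Ray S) {i : ℤ} (h : 0 ≤ i) : biPath r r' i = r.1 i.toNat :=
  if_pos h

theorem biPath_of_nonpos (r r' : Ray S) {i : ℤ} (h : i ≤ 0) :
    biPath r r' i = r'.1 (-i).toNat := by
  rcases h.eq_or_lt with rfl | h
  · simp [biPath, r.2.1, r'.2.1]
  · exact if_neg h.not_ge

theorem wordDist_biPath_add_one (hS : Subgroup.closure (S : Set Γ) = ⊤) (r r' : Ray S) (i : ℤ) :
    wordDist S (biPath r r' i) (biPath r r' (i + 1)) = 1 := by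
  rcases le_or_gt 0 i with h | h
  · rw [biPath_of_nonneg _ _ h, biPath_of_nonneg _ _ (by omega), r.wordDist_of_le (by omega)]
    omega
  · rw [biPath_of_nonpos _ _ h.le, biPath_of_nonpos _ _ (by omega), wordDist_comm hS,
      r'.wordDist_of_le (by omega)]
    omega

/-- Only segments passing through 1 need hyperbolicity. Uniformity of `B` in `i` allows every vertex
to serve as base point later. -/
theorem exists_le_wordDist_biPath (hS : Subgroup.closure (S : Set Γ) = ⊤)
    (hΓ : IsHyperbolic S) {r r' : Ray S} (h : ¬ (raySetoid S hS).r r r') :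
    ∃ B : ℕ, ∀ (i : ℤ) (k : ℕ), k ≤ wordDist S (biPath r r' i) (biPath r r' (i + k)) + B := by
  obtain ⟨B, hB⟩ := exists_le_wordDist_of_not_asymptotic hS hΓ h
  refine ⟨B, fun i k => ?_⟩
  rcases le_or_gt 0 i with hi | hi
  · rw [biPath_of_nonneg _ _ hi, biPath_of_nonneg _ _ (by omega), r.wordDist_of_le (by omega)]
    omega
  · rcases le_or_gt 0 (i + k) with hk | hk
    · rw [biPath_of_nonpos _ _ hi.le, biPath_of_nonneg _ _ hk, wordDist_comm hS]
      have := hB (i + k).toNat (-i).toNat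
      omega
    · rw [biPath_of_nonpos _ _ hi.le, biPath_of_nonpos _ _ hk.le, wordDist_comm hS,
        r'.wordDist_of_le (by omega)]
      omega

/-- A representation grows at most exponentially in the word length. -/
theorem norm_le_pow_wordLength (hS : Subgroup.closure (S : Set Γ) = ⊤) {R : Type*}
    [NormedRing R] [NormOneClass R] (π : Γ →* R) :
    ∃ κ : ℝ, 1 ≤ κ ∧ ∀ γ, ‖π γ‖ ≤ κ ^ wordLength S γ := by
  classical
  refine ⟨1 + ∑ s ∈ S, (‖π s‖ + ‖π s⁻¹‖),
    le_add_of_nonneg_right (Finset.sum_nonneg fun s _ => by positivity), fun γ => ?_⟩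
  set κ := 1 + ∑ s ∈ S, (‖π s‖ + ‖π s⁻¹‖) with hκ
  have hmem : ∀ s ∈ S, ‖π s‖ + ‖π s⁻¹‖ ≤ κ := fun s hs => by
    have := Finset.single_le_sum (f := fun s => ‖π s‖ + ‖π s⁻¹‖)
      (fun s _ => by positivity) hs
    linarith
  obtain ⟨l, hl, rfl, hlen⟩ := exists_word_length hS γ
  rw [← hlen]
  clear hlen
  induction l with
  | nil => simp
  | cons a l ih =>
    have ha : ‖π a‖ ≤ κ := by
      rcases hl a (by simp) with h | h
      · linarith [hmem a h, norm_nonneg (π a⁻¹)]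
      · have := hmem _ h
        rw [inv_inv] at this
        linarith [norm_nonneg (π a⁻¹)]
    rw [List.prod_cons, map_mul, List.length_cons, pow_succ']
    have := ih fun s hs => hl s (by simp [hs])
    have h0 : 0 ≤ κ := (norm_nonneg _).trans ha
    exact (norm_mul_le _ _).trans (by gcongr)

end WordMetric

/-! ### Limit maps and transversality -/

namespace AttractingLine

open InnerProductSpace WordMetric Filter Topology

variable {Γ : Type*} [Group Γ] {S : Finset Γ}
  {E : Type*} [NormedAddCommGroup E] [InnerProductSpace ℂ E] {π : Γ →* (E →L[ℂ] E)}

/-- Every `π γ` has an attracting line, with a rate exponential in the word length. -/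
def HasGap (S : Finset Γ) (π : Γ →* (E →L[ℂ] E)) (C μ : ℝ) : Prop :=
  ∀ γ, ∃ P, IsLineProj P ∧ Attracts (π γ) P (C * Real.exp (-(μ * wordLength S γ)))

theorem map_ne_zero_of_group [Nontrivial E]
    (π : Γ →* (E →L[ℂ] E)) (γ : Γ) : π γ ≠ 0 := by
  intro h
  have : π γ * π γ⁻¹ = 1 := by rw [← map_mul, mul_inv_cancel, map_one]
  rw [h, zero_mul] at this
  exact zero_ne_one this

theorem tendsto_mul_exp_neg (D : ℝ) {μ : ℝ} (hμ : 0 < μ) :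
    Tendsto (fun k : ℕ => D * Real.exp (-(μ * k))) atTop (𝓝 0) := by
  have h : Tendsto (fun k : ℕ => μ * (k : ℝ)) atTop atTop :=
    tendsto_natCast_atTop_atTop.const_mul_atTop hμ
  simpa using (Real.tendsto_exp_neg_atTop_nhds_zero.comp h).const_mul D

/-- Along a path going to infinity at linear speed the attracting lines converge, with a rate that
is uniform in the path. -/
theorem HasGap.exists_limit [FiniteDimensional ℂ E] [Nontrivial E]
    (hS : Subgroup.closure (S : Set Γ) = ⊤) {C μ : ℝ} (hC : 0 ≤ C)
    (hμ : 0 < μ) (h : HasGap S π C μ) (B : ℕ) :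
    ∃ D : ℝ, 0 ≤ D ∧ ∀ x : ℕ → Γ, (∀ k, wordDist S (x k) (x (k + 1)) ≤ 1) →
      (∀ k, k ≤ wordLength S (x k) + B) →
      ∃ P, IsLineProj P ∧ ∀ k : ℕ, Attracts (π (x k)) P (D * Real.exp (-(μ * k))) := by
  obtain ⟨κ, hκ1, hκ⟩ := norm_le_pow_wordLength hS π
  choose P hP hA using h
  -- The factor exp(μB) absorbs the defect in the bound k ≤ |x k| + B.
  set A : ℝ := C * Real.exp (μ * B) with hAdef
  have hA0 : 0 ≤ A := by positivity
  set A' : ℝ := 3 * (κ ^ 2 * A + A) with hA'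
  have hA'0 : 0 ≤ A' := by positivity
  set r : ℝ := Real.exp (-μ) with hr
  have hr1 : r < 1 := Real.exp_lt_one_iff.2 (by linarith)
  have hrk : ∀ k : ℕ, Real.exp (-(μ * k)) = r ^ k := fun k => by
    rw [hr, ← Real.exp_nat_mul]
    ring_nf
  have h1r : 0 < 1 - r := by linarith
  have hr0 : 0 < r := Real.exp_pos _
  refine ⟨A + A' / (1 - r), by positivity, fun x hx1 hx2 => ?_⟩
  have hatt : ∀ k, Attracts (π (x k)) (P (x k)) (A * r ^ k) := fun k => by
    refine (hA (x k)).mono ?_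
    rw [hAdef, ← hrk, mul_assoc, ← Real.exp_add]
    have : (k : ℝ) ≤ wordLength S (x k) + B := by exact_mod_cast hx2 k
    gcongr
    nlinarith
  have hle : ∀ γ, wordLength S γ ≤ 1 → ‖π γ‖ ≤ κ := fun γ hγ =>
    (hκ γ).trans ((pow_le_pow_right₀ hκ1 hγ).trans (pow_one κ).le)
  -- Consecutive vertices differ on the right by an element of length at most 1, so both lines
  -- attract π(x (k+1)) and near-uniqueness applies. `A'` does not depend on the path.
  have hstep : ∀ k, dist (P (x k)) (P (x (k + 1))) ≤ A' * r ^ k := fun k => by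
    have h1 : Attracts (π (x (k + 1))) (P (x k)) (κ ^ 2 * (A * r ^ k)) := by
      have := (hatt k).mul_right (by positivity)
        (s := π ((x k)⁻¹ * x (k + 1))) (t := π ((x (k + 1))⁻¹ * x k)) (κ := κ)
        (by rw [← map_mul, ← map_one π]; congr 1; group) (hle _ (hx1 k))
        (hle _ ((wordDist_comm_le hS _ _).trans (hx1 k)))
      rwa [← map_mul, mul_inv_cancel_left] at this
    have h2 : Attracts (π (x (k + 1))) (P (x (k + 1))) (A * r ^ k) :=
      (hatt (k + 1)).mono (by
        have : r ^ (k + 1) ≤ r ^ k := pow_le_pow_of_le_one hr0.le hr1.le (Nat.le_succ k)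
        gcongr)
    rw [dist_eq_norm]
    refine (h1.norm_sub_le (map_ne_zero_of_group π _) (hP _) (hP _) h2).trans (le_of_eq ?_)
    rw [hA']
    ring
  obtain ⟨Q, hQ⟩ := cauchySeq_tendsto_of_complete (cauchySeq_of_le_geometric r A' hr1 hstep)
  refine ⟨Q, isClosed_setOf_isLineProj.mem_of_tendsto hQ (Eventually.of_forall fun k => hP _),
    fun k => ?_⟩
  have h1 := dist_le_of_le_geometric_of_tendsto r A' hr1 hstep hQ k
  rw [dist_eq_norm] at h1
  refine ((hatt k).of_norm_sub_le h1).mono (le_of_eq ?_)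
  rw [hrk]
  ring

theorem eq_of_attracts [FiniteDimensional ℂ E] [Nontrivial E]
    {T : ℕ → E →L[ℂ] E} (hT : ∀ k, T k ≠ 0) {P Q : E →L[ℂ] E}
    (hP : IsLineProj P) (hQ : IsLineProj Q) {ε ε' : ℕ → ℝ} (hε : Tendsto ε atTop (𝓝 0))
    (hε' : Tendsto ε' atTop (𝓝 0)) (h : ∀ k, Attracts (T k) P (ε k))
    (h' : ∀ k, Attracts (T k) Q (ε' k)) : P = Q := by
  have h1 : Tendsto (fun k => 3 * (ε k + ε' k)) atTop (𝓝 0) := by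
    simpa using (hε.add hε').const_mul 3
  have h2 : ‖P - Q‖ ≤ 0 := ge_of_tendsto h1
    (Eventually.of_forall fun k => (h k).norm_sub_le (hT k) hP hQ (h' k))
  exact sub_eq_zero.1 (norm_le_zero_iff.1 h2)

/-- The limit map of a representation with a singular value gap. -/
theorem HasGap.exists_limitMap [FiniteDimensional ℂ E] [Nontrivial E]
    (hS : Subgroup.closure (S : Set Γ) = ⊤) {C μ : ℝ} (hC : 0 ≤ C)
    (hμ : 0 < μ) (h : HasGap S π C μ) :
    ∃ (Ξ : GromovBoundary S hS → (E →L[ℂ] E)) (D : ℝ), Continuous Ξ ∧ ∀ r : Ray S,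
      IsLineProj (Ξ (Quotient.mk (raySetoid S hS) r)) ∧
      ∀ k : ℕ, Attracts (π (r.1 k)) (Ξ (Quotient.mk (raySetoid S hS) r))
        (D * Real.exp (-(μ * k))) := by
  obtain ⟨κ, hκ1, hκ⟩ := norm_le_pow_wordLength hS π
  obtain ⟨D, hD, hlim⟩ := h.exists_limit hS hC hμ 0
  have hray : ∀ r : Ray S, ∃ P, IsLineProj P ∧
      ∀ k : ℕ, Attracts (π (r.1 k)) P (D * Real.exp (-(μ * k))) := fun r => by
    refine hlim r.1 (fun k => (r.2.2 k 1).le) fun k => ?_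
    have := r.wordDist_one k
    rw [wordDist, inv_one, one_mul] at this
    omega
  choose P hP hA using hray
  -- Rays with the same k-th vertex have limit lines that both attract the same operator, hence lie
  -- within 6 D exp(-μk) of each other.
  have hcont : Continuous P := by
    refine continuous_iff_continuousAt.2 fun r => Metric.tendsto_nhds.2 fun ε hε => ?_
    obtain ⟨k, hk⟩ := ((tendsto_mul_exp_neg (6 * D) hμ).eventually_lt_const hε).exists
    have hopen : IsOpen {r' : Ray S | r'.1 k = r.1 k} := by
      let tΓ : TopologicalSpace Γ := ⊥
      have : DiscreteTopology Γ := ⟨rfl⟩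
      exact isOpen_induced_iff.2 ⟨(fun f : ℕ → Γ => f k) ⁻¹' {r.1 k},
        (isOpen_discrete _).preimage (continuous_apply k), rfl⟩
    filter_upwards [hopen.mem_nhds rfl] with r' hr'
    have h1 := hA r' k
    rw [show r'.1 k = r.1 k from hr'] at h1
    rw [dist_eq_norm]
    refine (h1.norm_sub_le (map_ne_zero_of_group π _) (hP _) (hP _) (hA r k)).trans_lt ?_
    linarith
  -- Asymptotic rays differ on the right by elements of bounded length, which costs only a constant
  -- factor.
  have hresp : ∀ r r' : Ray S, (raySetoid S hS).r r r' → P r = P r' := by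
    rintro r r' ⟨c, hc⟩
    have hle : ∀ γ, wordLength S γ ≤ c → ‖π γ‖ ≤ κ ^ c := fun γ hγ =>
      (hκ γ).trans (pow_le_pow_right₀ hκ1 hγ)
    refine eq_of_attracts (T := fun k => π (r'.1 k)) (fun k => map_ne_zero_of_group π _) (hP r)
      (hP r') (ε := fun k => (κ ^ c) ^ 2 * (D * Real.exp (-(μ * k)))) ?_
      (tendsto_mul_exp_neg D hμ) (fun k => ?_) (hA r')
    · simpa using (tendsto_mul_exp_neg D hμ).const_mul ((κ ^ c) ^ 2)
    · have := (hA r k).mul_right (by positivity)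
        (s := π ((r.1 k)⁻¹ * r'.1 k)) (t := π ((r'.1 k)⁻¹ * r.1 k)) (κ := κ ^ c)
        (by rw [← map_mul, ← map_one π]; congr 1; group) (hle _ (hc k))
        (hle _ ((wordDist_comm_le hS _ _).trans (hc k)))
      rwa [← map_mul, mul_inv_cancel_left] at this
  exact ⟨Quotient.lift P hresp, D, hcont.quotient_lift hresp, fun r => ⟨hP r, hA r⟩⟩

/-- Equivariance of attracting lines. -/
theorem apply_eq_of_attracts [FiniteDimensional ℂ E] [Nontrivial E]
    {T : ℕ → E →L[ℂ] E} (hT : ∀ k, T k ≠ 0) (g : E →L[ℂ] E)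
    {P : E →L[ℂ] E} {u : E} (hu : ‖u‖ = 1) {ε ε' : ℕ → ℝ}
    (hε : Tendsto ε atTop (𝓝 0)) (hε' : Tendsto ε' atTop (𝓝 0)) (hε0 : ∀ k, 0 ≤ ε k)
    (h : ∀ k, Attracts (g * T k) P (ε k)) (h' : ∀ k, Attracts (T k) (rankOne ℂ u u) (ε' k)) :
    P (g u) = g u := by
  set q := ‖g u - P (g u)‖ with hq
  -- For `x` attaining ‖T k‖, the vector T k x is nearly a • u with |a| ≥ ‖T k‖ (1 - ε'), and its
  -- image under `g` is nearly in the range of `P`. Dividing by ‖T k‖ gives the inequality.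
  have key : ∀ k, q * (1 - ε' k) ≤ ε k * ‖g‖ + ‖g - P * g‖ * ε' k := fun k => by
    obtain ⟨x, hx, hTx⟩ := exists_norm_eq_one_norm_apply_eq (T k)
    have hpos : 0 < ‖T k‖ := norm_pos_iff.2 (hT k)
    set y := T k x
    set a : ℂ := inner ℂ u y with ha
    have e1 : ‖y - a • u‖ ≤ ε' k * ‖T k‖ := by
      simpa [hx] using (h' k).apply x
    have e2 : ‖T k‖ * (1 - ε' k) ≤ ‖a‖ := by
      have : ‖y‖ ≤ ‖y - a • u‖ + ‖a • u‖ := by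
        simpa using norm_add_le (y - a • u) (a • u)
      rw [hTx, norm_smul, hu] at this
      linarith
    have e3 : ‖g y - P (g y)‖ ≤ ε k * (‖g‖ * ‖T k‖) := by
      have := (h k).apply x
      rw [hx, mul_one] at this
      refine this.trans ?_
      have := hε0 k
      gcongr
      exact norm_mul_le _ _
    have e4 : a • (g u - P (g u)) = (g y - P (g y)) - (g - P * g) (y - a • u) := by
      simp only [sub_apply, mul_apply_eq_comp, map_sub, map_smul, smul_sub]
      abel
    have e5 : ‖a‖ * q ≤ ε k * (‖g‖ * ‖T k‖) + ‖g - P * g‖ * (ε' k * ‖T k‖) := by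
      rw [hq, ← norm_smul, e4]
      refine (norm_sub_le _ _).trans (add_le_add e3 (((g - P * g).le_opNorm _).trans ?_))
      gcongr
    have e6 : ‖T k‖ * (q * (1 - ε' k)) ≤ ‖T k‖ * (ε k * ‖g‖ + ‖g - P * g‖ * ε' k) := by
      nlinarith [mul_le_mul_of_nonneg_right e2 (norm_nonneg (g u - P (g u)))]
    exact le_of_mul_le_mul_left e6 hpos
  have l1 : Tendsto (fun k => q * (1 - ε' k)) atTop (𝓝 q) := by
    simpa using (hε'.const_sub 1).const_mul q
  have l2 : Tendsto (fun k => ε k * ‖g‖ + ‖g - P * g‖ * ε' k) atTop (𝓝 0) := by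
    simpa using (hε.mul_const ‖g‖).add (hε'.const_mul ‖g - P * g‖)
  have hq0 : q ≤ 0 := le_of_tendsto_of_tendsto' l1 l2 key
  exact (sub_eq_zero.1 (norm_le_zero_iff.1 hq0)).symm

/-- `ω` is a `π`-invariant alternating form that identifies the space isometrically, up to
conjugation, with its dual. -/
structure IsInvariantForm (π : Γ →* (E →L[ℂ] E)) (ω : E →ₗ[ℂ] E →ₗ[ℂ] ℂ) : Prop where
  swap : ∀ x y, ω x y = -ω y x
  norm_le : ∀ x y, ‖ω x y‖ ≤ ‖x‖ * ‖y‖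
  exists_dual : ∀ y, ∃ x, ‖x‖ ≤ ‖y‖ ∧ ‖y‖ ^ 2 ≤ ‖ω x y‖
  map_apply : ∀ γ x y, ω (π γ x) (π γ y) = ω x y

/-! ### Operator norms in the presence of an invariant form -/

namespace IsInvariantForm

variable {ω : E →ₗ[ℂ] E →ₗ[ℂ] ℂ}

/-- Testing `A y` against the vector from `exists_dual` recovers its norm, so ω-coefficients control
the operator norm. -/
theorem opNorm_le (hω : IsInvariantForm π ω) {A : E →L[ℂ] E} {c : ℝ} (hc : 0 ≤ c)
    (h : ∀ x y, ‖ω x (A y)‖ ≤ c * ‖x‖ * ‖y‖) : ‖A‖ ≤ c := by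
  refine A.opNorm_le_bound hc fun y => ?_
  obtain ⟨x, hx, hxy⟩ := hω.exists_dual (A y)
  rcases (norm_nonneg (A y)).eq_or_lt with h0 | h0
  · rw [← h0]
    positivity
  · have h1 : c * ‖x‖ * ‖y‖ ≤ c * ‖A y‖ * ‖y‖ := by gcongr
    have h2 : ‖A y‖ * ‖A y‖ ≤ ‖A y‖ * (c * ‖y‖) := by nlinarith [h x y]
    exact le_of_mul_le_mul_left h2 h0

theorem apply_inv (hω : IsInvariantForm π ω) (γ : Γ) (x y : E) :
    ω x (π γ⁻¹ y) = ω (π γ x) y := by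
  rw [← hω.map_apply γ x, ← mul_apply_eq_comp, ← map_mul, mul_inv_cancel, map_one]
  rfl

/-- By invariance π(γ⁻¹) is the ω-adjoint of π(γ). -/
theorem norm_map_inv_le (hω : IsInvariantForm π ω) (γ : Γ) : ‖π γ⁻¹‖ ≤ ‖π γ‖ := by
  refine hω.opNorm_le (norm_nonneg _) fun x y => ?_
  rw [hω.apply_inv]
  refine (hω.norm_le _ _).trans ?_
  gcongr
  exact (π γ).le_opNorm x

/-- This lower bound is what the doubling argument contradicts; it holds since 1 ≤ ‖π γ‖ ‖π γ⁻¹‖ ≤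
‖π γ‖². -/
theorem one_le_norm [Nontrivial E]
    (hω : IsInvariantForm π ω) (γ : Γ) : 1 ≤ ‖π γ‖ := by
  have h1 : π γ * π γ⁻¹ = 1 := by rw [← map_mul, mul_inv_cancel, map_one]
  have h2 := norm_mul_le (π γ) (π γ⁻¹)
  rw [h1, norm_one] at h2
  nlinarith [hω.norm_map_inv_le γ, norm_nonneg (π γ)]

/-- If the attracting lines of `γ` and `γ'` are `ω`-orthogonal, then the norm of `γ'⁻¹ γ` is much
smaller than the product of the norms. -/
theorem norm_map_inv_mul_le (hω : IsInvariantForm π ω) {γ γ' : Γ} {P P' : E →L[ℂ] E} {ε : ℝ}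
    (hε : 0 ≤ ε) (hP : IsLineProj P) (horth : ∀ x y, ω (P' x) (P y) = 0)
    (h : Attracts (π γ) P ε) (h' : Attracts (π γ') P' ε) :
    ‖π (γ'⁻¹ * γ)‖ ≤ 2 * ε * ‖π γ'‖ * ‖π γ‖ := by
  refine hω.opNorm_le (by positivity) fun x y => ?_
  set a := π γ' x
  set b := π γ y
  -- The main term ω(P' a, P b) vanishes by orthogonality; each of the two remainders costs a factor
  -- `ε`.
  have e0 : ω x (π (γ'⁻¹ * γ) y) = ω (a - P' a) (P b) + ω a (b - P b) := by
    rw [map_mul, mul_apply_eq_comp, hω.apply_inv]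
    simp [horth, a, b]
  have ha : ‖a‖ ≤ ‖π γ'‖ * ‖x‖ := (π γ').le_opNorm x
  have hb : ‖b‖ ≤ ‖π γ‖ * ‖y‖ := (π γ).le_opNorm y
  have hPb : ‖P b‖ ≤ ‖b‖ := by simpa [hP.norm_eq] using P.le_opNorm b
  have t1 : ‖ω (a - P' a) (P b)‖ ≤ (ε * ‖π γ'‖ * ‖x‖) * (‖π γ‖ * ‖y‖) :=
    (hω.norm_le _ _).trans (mul_le_mul (h'.apply x) (hPb.trans hb) (norm_nonneg _)
      (by positivity))
  have t2 : ‖ω a (b - P b)‖ ≤ (‖π γ'‖ * ‖x‖) * (ε * ‖π γ‖ * ‖y‖) :=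
    (hω.norm_le _ _).trans (mul_le_mul ha (h.apply y) (norm_nonneg _) (by positivity))
  rw [e0]
  calc _ ≤ _ := (norm_add_le _ _).trans (add_le_add t1 t2)
    _ = _ := by ring

end IsInvariantForm

/-- A family of numbers at least `1` cannot be strongly submultiplicative under doubling. -/
theorem not_forall_doubling_le {M : ℤ → ℕ → ℝ} {A κ μ : ℝ} (hμ : 0 < μ) (hM : ∀ i p, 1 ≤ M i p)
    (h0 : ∀ i, M i 0 ≤ κ)
    (hd : ∀ i p, M i (p + 1) ≤ A * Real.exp (-(μ * 2 ^ p)) * M i p * M (i + 2 ^ p) p) : False := by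
  have hκ : 0 < κ := by linarith [hM 0 0, h0 0]
  set b := Real.log κ
  set a := Real.log (max A 1)
  have ha : Real.exp a = max A 1 := Real.exp_log (by positivity)
  have ha0 : 0 ≤ a := Real.log_nonneg (le_max_right _ _)
  -- For L = log M the hypothesis reads L(p+1) ≤ a - μ 2^p + L(p) + L(p). Adding `a` to L absorbs
  -- the constant, and after division by 2^p each doubling lowers the bound by μ/2.
  have key : ∀ p i, M i p ≤ Real.exp (2 ^ p * (b + a - p * μ / 2) - a) := by
    intro p
    induction p with
    | zero =>
      intro i
      simpa [b, Real.exp_log hκ] using h0 i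
    | succ p ih =>
      intro i
      have h1 := hM i p
      have h2 := hM (i + 2 ^ p) p
      calc M i (p + 1) ≤ A * Real.exp (-(μ * 2 ^ p)) * M i p * M (i + 2 ^ p) p := hd i p
        _ ≤ Real.exp a * Real.exp (-(μ * 2 ^ p)) *
            Real.exp (2 ^ p * (b + a - p * μ / 2) - a) *
            Real.exp (2 ^ p * (b + a - p * μ / 2) - a) := by
          have := ha.symm ▸ le_max_left A 1
          gcongr
          · exact ih i
          · exact ih _
        _ = Real.exp (2 ^ (p + 1) * (b + a - (p + 1 : ℕ) * μ / 2) - a) := by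
          rw [← Real.exp_add, ← Real.exp_add, ← Real.exp_add]
          congr 1
          push_cast
          ring
  obtain ⟨p, hp⟩ := exists_nat_gt ((b + a) * 2 / μ)
  have hp' : b + a - p * μ / 2 < 0 := by
    rw [div_lt_iff₀ hμ] at hp
    linarith
  have h1 := (hM 0 p).trans (key p 0)
  have h2 : (2 : ℝ) ^ p * (b + a - p * μ / 2) - a < 0 := by
    have : (2 : ℝ) ^ p * (b + a - p * μ / 2) < 0 := mul_neg_of_pos_of_neg (by positivity) hp'
    linarith
  linarith [Real.exp_lt_one_iff.2 h2]

/-- Limit lines of distinct boundary points are not orthogonal for an invariant form. -/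
theorem IsInvariantForm.ne_zero_of_not_asymptotic [FiniteDimensional ℂ E] [Nontrivial E]
    {ω : E →ₗ[ℂ] E →ₗ[ℂ] ℂ}
    (hω : IsInvariantForm π ω) (hS : Subgroup.closure (S : Set Γ) = ⊤) (hΓ : IsHyperbolic S)
    {C μ : ℝ} (hC : 0 ≤ C) (hμ : 0 < μ) (hgap : HasGap S π C μ) {r r' : Ray S}
    (hr : ¬ (raySetoid S hS).r r r') {u u' : E} {D : ℝ}
    (h : ∀ k : ℕ, Attracts (π (r.1 k)) (rankOne ℂ u u) (D * Real.exp (-(μ * k))))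
    (h' : ∀ k : ℕ, Attracts (π (r'.1 k)) (rankOne ℂ u' u') (D * Real.exp (-(μ * k)))) :
    ω u' u ≠ 0 := by
  intro h0
  obtain ⟨κ, hκ1, hκ⟩ := norm_le_pow_wordLength hS π
  obtain ⟨B, hB⟩ := exists_le_wordDist_biPath hS hΓ hr
  obtain ⟨D', hD', hlim⟩ := hgap.exists_limit hS hC hμ B
  set x : ℤ → Γ := biPath r r' with hx
  have hx1 : ∀ i, wordDist S (x i) (x (i + 1)) = 1 := wordDist_biPath_add_one hS r r'
  -- The path is translated so that its j-th vertex is 1; the constant `D'` is the same for all j.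
  have hfwd : ∀ j : ℤ, ∃ v : E, ‖v‖ = 1 ∧ ∀ k : ℕ,
      Attracts (π ((x j)⁻¹ * x (j + k))) (rankOne ℂ v v) (D' * Real.exp (-(μ * k))) := by
    intro j
    obtain ⟨P, ⟨v, hv, rfl⟩, hP⟩ := hlim (fun k => (x j)⁻¹ * x (j + k))
      (fun k => by
        rw [wordDist_mul_left]
        have := hx1 (j + k)
        rw [add_assoc] at this
        exact_mod_cast this.le) (fun k => hB j k)
    exact ⟨v, hv, hP⟩
  have hbwd : ∀ j : ℤ, ∃ v : E, ‖v‖ = 1 ∧ ∀ k : ℕ,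
      Attracts (π ((x j)⁻¹ * x (j - k))) (rankOne ℂ v v) (D' * Real.exp (-(μ * k))) := by
    intro j
    obtain ⟨P, ⟨v, hv, rfl⟩, hP⟩ := hlim (fun k => (x j)⁻¹ * x (j - k))
      (fun k => by
        rw [wordDist_mul_left, wordDist_comm hS]
        have := hx1 (j - (k + 1 : ℕ))
        rw [show j - (k + 1 : ℕ) + 1 = j - k by push_cast; ring] at this
        exact this.le)
      (fun k => by
        have := hB (j - k) k
        rwa [sub_add_cancel, wordDist_comm hS] at this)
    exact ⟨v, hv, hP⟩
  choose v hv hvA using hfwd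
  choose v' hv' hvA' using hbwd
  have hD0 : 0 ≤ D := by
    by_contra! hneg
    have h1 := (norm_nonneg _).trans (h 0)
    have h2 := hω.one_le_norm (r.1 0)
    have : D * Real.exp (-(μ * (0 : ℕ))) < 0 := mul_neg_of_neg_of_pos hneg (Real.exp_pos _)
    nlinarith
  have hanti : ∀ {F : ℝ} {k n : ℕ}, 0 ≤ F → k ≤ n →
      F * Real.exp (-(μ * n)) ≤ F * Real.exp (-(μ * k)) := fun hF hkn => by
    have : ((_ : ℕ) : ℝ) ≤ (_ : ℕ) := Nat.cast_le.2 hkn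
    gcongr
  -- π(x j) carries the forward limit line seen from `x j` to the line of `u`. The shift by |j|
  -- keeps j + k + |j| nonnegative and at least k, so the path has entered `r`.
  have hequi : ∀ j, rankOne ℂ u u (π (x j) (v j)) = π (x j) (v j) := fun j => by
    refine apply_eq_of_attracts (T := fun k : ℕ => π ((x j)⁻¹ * x (j + (k + j.natAbs : ℕ))))
      (fun k => map_ne_zero_of_group π _) _ (hv j) (tendsto_mul_exp_neg D hμ)
      (tendsto_mul_exp_neg D' hμ) (fun k => by positivity) (fun k => ?_)
      (fun k => (hvA j _).mono (hanti hD' (Nat.le_add_right _ _)))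
    rw [← map_mul, mul_inv_cancel_left, hx, biPath_of_nonneg _ _ (by omega)]
    exact (h _).mono (hanti hD0 (by omega))
  have hequi' : ∀ j, rankOne ℂ u' u' (π (x j) (v' j)) = π (x j) (v' j) := fun j => by
    refine apply_eq_of_attracts (T := fun k : ℕ => π ((x j)⁻¹ * x (j - (k + j.natAbs : ℕ))))
      (fun k => map_ne_zero_of_group π _) _ (hv' j) (tendsto_mul_exp_neg D hμ)
      (tendsto_mul_exp_neg D' hμ) (fun k => by positivity) (fun k => ?_)
      (fun k => (hvA' j _).mono (hanti hD' (Nat.le_add_right _ _)))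
    rw [← map_mul, mul_inv_cancel_left, hx, biPath_of_nonpos _ _ (by omega)]
    exact (h' _).mono (hanti hD0 (by omega))
  -- Invariance of ω carries the assumed orthogonality of `u'` and `u` to every vertex.
  have horth : ∀ j y z, ω (rankOne ℂ (v' j) (v' j) y) (rankOne ℂ (v j) (v j) z) = 0 := by
    intro j y z
    have : ω (v' j) (v j) = 0 := by
      rw [← hω.map_apply (x j), ← hequi, ← hequi']
      simp [h0]
    simp [this]
  refine not_forall_doubling_le (M := fun i p => ‖π ((x i)⁻¹ * x (i + 2 ^ p))‖) (A := 2 * D')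
    (κ := κ) hμ (fun i p => hω.one_le_norm _) (fun i => ?_) (fun i p => ?_)
  · have h1 := hκ ((x i)⁻¹ * x (i + 1))
    have h2 := hx1 i
    rw [wordDist] at h2
    simpa [h2] using h1
  -- The segment is split at its midpoint: γ is the forward half, γ' the backward half, and γ'⁻¹γ
  -- the whole. The backward half is the inverse of the first half, so its norm is bounded by `M i
  -- p`.
  · have h1 := hvA (i + 2 ^ p) (2 ^ p)
    have h2 := hvA' (i + 2 ^ p) (2 ^ p)
    have h3 := hω.norm_map_inv_mul_le (by positivity) ⟨_, hv _, rfl⟩ (horth _) h1 h2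
    have h4 : ‖π ((x (i + 2 ^ p))⁻¹ * x i)‖ ≤ ‖π ((x i)⁻¹ * x (i + 2 ^ p))‖ := by
      have := hω.norm_map_inv_le ((x i)⁻¹ * x (i + 2 ^ p))
      rwa [mul_inv_rev, inv_inv] at this
    push_cast at h3
    rw [add_sub_cancel_right, show ((x (i + 2 ^ p))⁻¹ * x i)⁻¹ *
      ((x (i + 2 ^ p))⁻¹ * x (i + 2 ^ p + 2 ^ p)) = (x i)⁻¹ * x (i + 2 ^ p + 2 ^ p) by group,
      show i + 2 ^ p + 2 ^ p = i + 2 ^ (p + 1) by ring] at h3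
    have h5 : i + 2 ^ p + 2 ^ p = i + 2 ^ (p + 1) := by ring
    simp only [h5]
    refine h3.trans ?_
    rw [← mul_assoc 2 D']
    gcongr

/-- A space with a continuous transverse map to lines does not properly contain a two-sphere. -/
theorem IsInvariantForm.not_homeomorph_sphere [FiniteDimensional ℂ E]
    {ω : E →ₗ[ℂ] E →ₗ[ℂ] ℂ}
    (hω : IsInvariantForm π ω) {X : Type*} [TopologicalSpace X] {Ξ : X → (E →L[ℂ] E)}
    (hΞ : Continuous Ξ) {u : X → E} (hΞu : ∀ a, Ξ a = rankOne ℂ (u a) (u a))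
    (htrans : ∀ a b, a ≠ b → ω (u a) (u b) ≠ 0) {A : Set X} (hA : A ≠ Set.univ)
    (φ : Metric.sphere (0 : EuclideanSpace ℝ (Fin 3)) 1 ≃ₜ A) : False := by
  obtain ⟨y, hy⟩ := (Set.ne_univ_iff_exists_notMem A).1 hA
  -- The vectors `u a` need not depend continuously on a. Projecting the fixed vector `w` to the
  -- line of a does, and the result is nonzero because ω(u a, u y) ≠ 0 for a in A.
  obtain ⟨w, hw⟩ : ∃ w, ∀ x, inner ℂ w x = ω x (u y) :=
    ⟨(toDual ℂ E).symm (LinearMap.toContinuousLinearMap (ω.flip (u y))), fun x => by simp⟩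
  let f : Metric.sphere (0 : EuclideanSpace ℝ (Fin 3)) 1 → E := fun x => Ξ (φ x) w
  have hf : Continuous f :=
    (hΞ.comp (continuous_subtype_val.comp φ.continuous)).clm_apply continuous_const
  have hfu : ∀ x, ∃ c : ℂ, c ≠ 0 ∧ f x = c • u (φ x) := fun x => by
    refine ⟨inner ℂ (u (φ x)) w, ?_, by simp only [f, hΞu, rankOne_apply]⟩
    rw [← inner_conj_symm, hw]
    exact (map_ne_zero _).2 (htrans _ _ fun h => hy (h ▸ (φ x).2))
  let b : E →L[ℂ] E →L[ℂ] ℂ := ω.mkContinuous₂ 1 fun x y => by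
    rw [one_mul]
    exact hω.norm_le x y
  obtain ⟨x, hx⟩ := BorsukUlam.exists_eq_zero_of_odd (g := fun x => b (f x) (f (-x)))
    ((b.continuous.comp hf).clm_apply (hf.comp continuous_neg))
    (fun x => by rw [neg_neg]; exact hω.swap _ _)
  obtain ⟨c, hc, hcx⟩ := hfu x
  obtain ⟨c', hc', hcx'⟩ := hfu (-x)
  have hx' : c' * (c * ω (u (φ x)) (u (φ (-x)))) = 0 := by
    rw [← hx]
    change _ = ω (f x) (f (-x))
    simp [hcx, hcx']
  simp only [mul_eq_zero, hc, hc', false_or] at hx'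
  refine htrans _ _ (fun h => ?_) hx'
  have hxx : (x : EuclideanSpace ℝ (Fin 3)) = -x :=
    congrArg Subtype.val (φ.injective (Subtype.ext h))
  have hx0 : (x : EuclideanSpace ℝ (Fin 3)) = 0 := by
    have : IsAddTorsionFree (EuclideanSpace ℝ (Fin 3)) := .of_isTorsionFree ℝ _
    exact self_eq_neg.1 hxx
  have hx1 : ‖(x : EuclideanSpace ℝ (Fin 3))‖ = 1 := by simp
  rw [hx0, norm_zero] at hx1
  exact zero_ne_one hx1

end AttractingLine

/-! ### The symplectic form on Euclidean space -/

namespace Anosov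

open InnerProductSpace WordMetric AttractingLine Matrix

/-- The standard symplectic form on `ℂ²ᵐ`. -/
noncomputable def sympForm (m : ℕ) :
    EuclideanSpace ℂ (Fin m ⊕ Fin m) →ₗ[ℂ] EuclideanSpace ℂ (Fin m ⊕ Fin m) →ₗ[ℂ] ℂ :=
  (Matrix.toLinearMap₂' ℂ (Matrix.J (Fin m) ℂ)).compl₁₂
    (WithLp.linearEquiv 2 ℂ (Fin m ⊕ Fin m → ℂ)).toLinearMap
    (WithLp.linearEquiv 2 ℂ (Fin m ⊕ Fin m → ℂ)).toLinearMap

theorem sympForm_apply {m : ℕ} (x y : EuclideanSpace ℂ (Fin m ⊕ Fin m)) :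
    sympForm m x y = x.ofLp ⬝ᵥ (Matrix.J (Fin m) ℂ *ᵥ y.ofLp) := by
  simp [sympForm, Matrix.toLinearMap₂'_apply']

theorem norm_toLp_J_mulVec {m : ℕ} (y : EuclideanSpace ℂ (Fin m ⊕ Fin m)) :
    ‖WithLp.toLp 2 (Matrix.J (Fin m) ℂ *ᵥ y.ofLp)‖ = ‖y‖ := by
  rw [EuclideanSpace.norm_eq, EuclideanSpace.norm_eq]
  congr 1
  simp [Matrix.J, Matrix.fromBlocks_mulVec, Fintype.sum_sum_type, Matrix.neg_mulVec, add_comm]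

theorem norm_toLp_star {m : ℕ} (y : EuclideanSpace ℂ (Fin m ⊕ Fin m)) :
    ‖WithLp.toLp 2 (star y.ofLp)‖ = ‖y‖ := by
  rw [EuclideanSpace.norm_eq, EuclideanSpace.norm_eq]
  simp

/-- Conjugation and J preserve the Hermitian norm, so Cauchy–Schwarz bounds the form, and its
equality case supplies the dual vectors. -/
theorem sympForm_eq_inner {m : ℕ} (x y : EuclideanSpace ℂ (Fin m ⊕ Fin m)) :
    sympForm m x y = inner ℂ (WithLp.toLp 2 (star x.ofLp))
      (WithLp.toLp 2 (Matrix.J (Fin m) ℂ *ᵥ y.ofLp)) := by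
  rw [sympForm_apply, EuclideanSpace.inner_eq_star_dotProduct, star_star, dotProduct_comm]

/-- The linear representation on Euclidean space defined by a symplectic representation. -/
noncomputable def linearRep {Γ : Type*} [Group Γ] {m : ℕ}
    (ρ : Γ →* Matrix.symplecticGroup (Fin m) ℂ) :
    Γ →* (EuclideanSpace ℂ (Fin m ⊕ Fin m) →L[ℂ] EuclideanSpace ℂ (Fin m ⊕ Fin m)) :=
  ((Matrix.toEuclideanCLM (n := Fin m ⊕ Fin m) (𝕜 := ℂ) : _ →* _).comp
    (Matrix.symplecticGroup (Fin m) ℂ).subtype).comp ρ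

theorem linearRep_apply {Γ : Type*} [Group Γ] {m : ℕ}
    (ρ : Γ →* Matrix.symplecticGroup (Fin m) ℂ) (γ : Γ) :
    linearRep ρ γ = Matrix.toEuclideanCLM (n := Fin m ⊕ Fin m) (𝕜 := ℂ) (ρ γ).1 := rfl

theorem isInvariantForm_sympForm {Γ : Type*} [Group Γ] {m : ℕ}
    (ρ : Γ →* Matrix.symplecticGroup (Fin m) ℂ) :
    IsInvariantForm (linearRep ρ) (sympForm m) where
  swap x y := by
    rw [sympForm_apply, sympForm_apply, dotProduct_mulVec, ← mulVec_transpose,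
      Matrix.J_transpose, neg_mulVec, neg_dotProduct, dotProduct_comm]
  norm_le x y := by
    rw [sympForm_eq_inner, ← norm_toLp_star x, ← norm_toLp_J_mulVec y]
    exact norm_inner_le_norm _ _
  exists_dual y := by
    refine ⟨WithLp.toLp 2 (star (Matrix.J (Fin m) ℂ *ᵥ y.ofLp)), ?_, ?_⟩
    · have := norm_toLp_star (WithLp.toLp 2 (Matrix.J (Fin m) ℂ *ᵥ y.ofLp))
      rw [norm_toLp_J_mulVec] at this
      exact this.le
    · rw [sympForm_eq_inner]
      simp only [star_star]
      rw [inner_self_eq_norm_sq_to_K, norm_toLp_J_mulVec]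
      simp
  map_apply γ x y := by
    have h := SymplecticGroup.mem_iff'.1 (ρ γ).2
    rw [sympForm_apply, sympForm_apply, linearRep_apply, ofLp_toEuclideanCLM,
      ofLp_toEuclideanCLM, mulVec_mulVec, ← vecMul_transpose, ← dotProduct_mulVec,
      mulVec_mulVec, ← Matrix.mul_assoc, h]

theorem hasGap_linearRep {Γ : Type*} [Group Γ] {S : Finset Γ} {m : ℕ} (hm : 1 ≤ m)
    (ρ : Γ →* Matrix.symplecticGroup (Fin m) ℂ) (hρ : IsAnosov S 1 ((spToSL m).comp ρ)) :
    ∃ C μ : ℝ, 0 ≤ C ∧ 0 < μ ∧ HasGap S (linearRep ρ) C μ := by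
  have : Nonempty (Fin m) := ⟨⟨0, hm⟩⟩
  obtain ⟨-, -, c, μ, hc, hμ, h⟩ := hρ
  refine ⟨c⁻¹, μ, by positivity, hμ, fun γ => exists_attracts _ ?_ (by positivity)⟩
  set L := (linearRep ρ γ).toLinearMap with hL
  have h1 : c * Real.exp (μ * wordLength S γ) ≤ L.singularValues 0 / L.singularValues 1 := h γ
  have h2 : 0 < L.singularValues 0 / L.singularValues 1 := lt_of_lt_of_le (by positivity) h1
  -- Division by 0 would give the quotient 0, against its positive lower bound.
  have h3 : 0 < L.singularValues 1 := by
    refine lt_of_le_of_ne (L.singularValues_nonneg 1) fun h0 => ?_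
    rw [← h0, div_zero] at h2
    exact lt_irrefl _ h2
  rw [le_div_iff₀ h3] at h1
  rw [Real.exp_neg, ← mul_inv, inv_mul_eq_div, le_div_iff₀ (by positivity)]
  linarith

end Anosov

/-! ### The main theorem -/

open InnerProductSpace WordMetric AttractingLine in
theorem theorem1p2 {Γ : Type*} [Group Γ] (S : Finset Γ)
    (hS : Subgroup.closure (S : Set Γ) = ⊤) (hΓ : WordMetric.IsHyperbolic S)
    (m : ℕ) (hm : 1 ≤ m) (ρ : Γ →* Matrix.symplecticGroup (Fin m) ℂ)
    (hρ : Anosov.IsAnosov S 1 ((Anosov.spToSL m).comp ρ)) :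
    ¬ ∃ A : Set (WordMetric.GromovBoundary S hS),
        A ≠ Set.univ ∧ Nonempty (Metric.sphere (0 : EuclideanSpace ℝ (Fin 3)) 1 ≃ₜ A) := by
  rintro ⟨A, hA, ⟨φ⟩⟩
  have : Nonempty (Fin m) := ⟨⟨0, hm⟩⟩
  obtain ⟨C, μ, hC, hμ, hgap⟩ := Anosov.hasGap_linearRep hm ρ hρ
  have hω := Anosov.isInvariantForm_sympForm ρ
  obtain ⟨Ξ, D, hΞ, hlim⟩ := hgap.exists_limitMap hS hC hμ
  have hline : ∀ a, ∃ u, ‖u‖ = 1 ∧ Ξ a = rankOne ℂ u u := fun a =>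
    Quotient.inductionOn a fun r => (hlim r).1
  choose u hu hΞu using hline
  refine hω.not_homeomorph_sphere hΞ hΞu (fun a b => ?_) hA φ
  refine Quotient.inductionOn₂ a b fun r r' hab => ?_
  -- The rays are swapped because transversality is stated with the line of the second ray in the
  -- first slot of the form.
  refine hω.ne_zero_of_not_asymptotic hS hΓ hC hμ hgap (r := r') (r' := r) (D := D)
    (fun h => hab (Quotient.sound h).symm) (fun k => ?_) (fun k => ?_)
  · exact (congrArg (fun P => Attracts _ P _) (hΞu _)).mp ((hlim r').2 k)
  · exact (congrArg (fun P => Attracts _ P _) (hΞu _)).mp ((hlim r).2 k)
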